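/- An inversion sequence of length $n$ is an integer sequence $(a_1,\dots,a_n)$ with $0\le a_i<i$ for all $i$ (for $n=0$ there is exactly one, the empty sequence). Let $\mathcal I_n(-,-,>)$ be the set of inversion sequences of length $n$ for which there are no $i<j<k$ with $a_i>a_k$ (the relation $-$ imposes no condition), and for a set $S$ of patterns let $\mathcal I_n(S)$ be the set of inversion sequences of length $n$ that contain no subsequence, not necessarily consecutive, in the same relative order (including equalities) as some pattern in $S$. Then $\mathcal I_n(-,-,>)=\mathcal I_n(100,110,120,201,210)$ for all $n\ge 0$. There is exactly one formal power series $X=X(z)\in\mathbb Q[[z]]$ that satisfies $$1-X+z-zX+2zX^2-z^2X^3=0,$$ it begins $X=1+2z+5z^2+17z^3+64z^4+\cdots$, and the generating function $F(z)=\sum_{n\ge0}|\mathcal I_n(-,-,>)|\,z^n$ is given by $$F(z)=\frac{(1+z)(X-1)-z(1-z)X^2}{z(1+z)X}.$$ Moreover $F$ is algebraic over $\mathbb Q(z)$, and its minimal polynomial over $\mathbb Q(z)$, up to normalization by a nonzero element of $\mathbb Q(z)$, is $$-(z+1)F^3+4F^2-4F+1.$$ -/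

import Mathlib

/-- The inversion sequences of length `n`. Positions are indexed from `0`, so the condition
`0 ≤ a_i < i` for `i = 1, …, n` reads `a i < i + 1` for `i : Fin n`. -/
def invSeq (n : ℕ) : Set (Fin n → ℕ) :=
  {a | ∀ i : Fin n, a i < (i : ℕ) + 1}

theorem invSeq_finite (n : ℕ) : (invSeq n).Finite := by
  have h : (Set.pi Set.univ (fun i : Fin n => Set.Iio ((i : ℕ) + 1))).Finite :=
    Set.Finite.pi (fun i => Set.finite_Iio _)
  exact h.subset (fun a ha i _ => ha i)

/-- The relation `-`, which imposes no restriction. -/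
def noRel : ℕ → ℕ → Prop := fun _ _ => True

/-- `I_n(ρ₁, ρ₂, ρ₃)`: the inversion sequences of length `n` avoiding a triple of relations. -/
def invSeqAvoidRel (ρ₁ ρ₂ ρ₃ : ℕ → ℕ → Prop) (n : ℕ) : Set (Fin n → ℕ) :=
  {a | a ∈ invSeq n ∧
    ¬ ∃ i j k : Fin n, i < j ∧ j < k ∧ ρ₁ (a i) (a j) ∧ ρ₂ (a j) (a k) ∧ ρ₃ (a i) (a k)}

theorem invSeqAvoidRel_finite (ρ₁ ρ₂ ρ₃ : ℕ → ℕ → Prop) (n : ℕ) :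
    (invSeqAvoidRel ρ₁ ρ₂ ρ₃ n).Finite :=
  (invSeq_finite n).subset (fun _ ha => ha.1)

/-- The reduction of a word: the smallest entries become `0`, the next smallest `1`, and so on;
that is, each entry is replaced by the number of distinct smaller values in the word. -/
def reduction {k : ℕ} (w : Fin k → ℕ) : Fin k → ℕ :=
  fun i => ((Finset.univ.image w).filter (fun v => v < w i)).card

/-- `a` contains the pattern `σ`: some subsequence of `a` has reduction `σ`. -/
def containsPattern {n k : ℕ} (a : Fin n → ℕ) (σ : Fin k → ℕ) : Prop :=
  ∃ f : Fin k → Fin n, StrictMono f ∧ reduction (a ∘ f) = σ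

/-- `I_n(S)`: the inversion sequences of length `n` avoiding all patterns in `S`. -/
def invSeqAvoidPat {k : ℕ} (S : Set (Fin k → ℕ)) (n : ℕ) : Set (Fin n → ℕ) :=
  {a | a ∈ invSeq n ∧ ∀ σ ∈ S, ¬ containsPattern a σ}

/-- The generating function `∑ₙ |I_n(ρ₁, ρ₂, ρ₃)| zⁿ`, as a formal power series over `ℚ`. -/
noncomputable def invSeqGF (ρ₁ ρ₂ ρ₃ : ℕ → ℕ → Prop) : PowerSeries ℚ :=
  PowerSeries.mk (fun n => ((invSeqAvoidRel ρ₁ ρ₂ ρ₃ n).ncard : ℚ))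

/-- The kernel `1 - x + z - z x + 2 z x² - z² x³`, where `z` is the variable of the power series
ring and a power series is substituted for `x`. -/
noncomputable def kernel1420 (x : PowerSeries ℚ) : PowerSeries ℚ :=
  1 - x + PowerSeries.X - PowerSeries.X * x + 2 * PowerSeries.X * x ^ 2
    - PowerSeries.X ^ 2 * x ^ 3

/-- A formal power series over `ℚ`, viewed as an element of the field `ℚ((z))`, which is an
extension of the field `ℚ(z)` of rational functions. -/
noncomputable def toLaurent (f : PowerSeries ℚ) : LaurentSeries ℚ :=
  (f : LaurentSeries ℚ)

/-- The inclusion of `ℚ(z)` in `ℚ((z))`. This is Mathlib's instance, made available for this pair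
of fields only (as a scoped instance it would also apply to `ℚ(z)` over itself). -/
noncomputable instance ratFuncAlgebraLaurent : Algebra (RatFunc ℚ) (LaurentSeries ℚ) :=
  RatFunc.liftAlgebra ℚ (LaurentSeries ℚ)

theorem algebraMap_ratFunc_X :
    algebraMap (RatFunc ℚ) (LaurentSeries ℚ) RatFunc.X = toLaurent PowerSeries.X := by
  rw [toLaurent, HahnSeries.ofPowerSeries_X]
  exact RatFunc.coe_X

/-! Avoidance means `a i ≤ a k` whenever `k` is at least two places after `i`, so when a sequence is
built from left to right the next entry is bounded below by the maximum `p` of all entries but the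
last. The possible futures depend only on `h` (length minus maximum) and `d` (last rise of the
maximum).

The count is affine in `d`, which leaves one series B_h for each `h`. Differencing twice gives a
linear recurrence in `h` of order three with coefficients in ℚ[z]. If X is the kernel root, then u =
zX is the reciprocal of a characteristic root, and u has no constant term; this kills one factor of
the recurrence and, with the initial relations, gives F = (1 - u)/(1 - u - z) (`invSeqGF_mul_eq`).

Eliminating u yields the cubic for F. It has no root in ℚ(z), hence is irreducible. -/

/-! ### The two avoidance classes -/

theorem mem_invSeqAvoidRel_iff {n : ℕ} (a : Fin n → ℕ) :
    a ∈ invSeqAvoidRel noRel noRel (· > ·) n ↔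
      (∀ i, a i ≤ (i : ℕ)) ∧ ∀ i k : Fin n, (i : ℕ) + 2 ≤ k → a i ≤ a k := by
  simp only [invSeqAvoidRel, invSeq, noRel, Set.mem_ofPred_eq, true_and, Nat.lt_succ_iff]
  refine and_congr_right fun _ => ⟨fun h i k hik => ?_, ?_⟩
  · by_contra hlt
    exact h ⟨i, ⟨i + 1, by omega⟩, k, by simp [Fin.lt_def], by simp [Fin.lt_def]; omega,
      not_le.mp hlt⟩
  · rintro h ⟨i, j, k, hij, hjk, hlt⟩
    have := h i k (by simp only [Fin.lt_def] at hij hjk; omega)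
    omega

theorem reduction_le_reduction {k : ℕ} {w : Fin k → ℕ} {i j : Fin k} (h : w i ≤ w j) :
    reduction w i ≤ reduction w j := by
  refine Finset.card_le_card fun v hv => ?_
  simp only [Finset.mem_filter] at hv ⊢
  exact ⟨hv.1, hv.2.trans_le h⟩

/-- The five patterns are all the order types of three letters whose last is below the first; the
cases are the possible places of the middle letter. -/
theorem reduction_mem_of_lt {w : Fin 3 → ℕ} (h : w 2 < w 0) :
    reduction w ∈ ({![1, 0, 0], ![1, 1, 0], ![1, 2, 0], ![2, 0, 1], ![2, 1, 0]} :
      Set (Fin 3 → ℕ)) := by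
  have huniv : (Finset.univ : Finset (Fin 3)) = {0, 1, 2} := rfl
  have key : ∀ i, reduction w i = ((({w 0, w 1, w 2} : Finset ℕ)).filter (· < w i)).card := by
    intro i
    simp [reduction, huniv, Finset.image_insert]
  have hred : reduction w = ![reduction w 0, reduction w 1, reduction w 2] := by
    ext i; fin_cases i <;> rfl
  rw [hred, key, key, key]
  generalize w 0 = x at *
  generalize w 1 = y at *
  generalize w 2 = t at *
  rcases lt_trichotomy y t with h1 | h1 | h1
  · have : ¬ t < y := by omega
    have : ¬ x < y := by omega
    have : ¬ x < t := by omega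
    have : y < x := by omega
    have : y ≠ t := by omega
    simp [Finset.filter_insert, Finset.filter_singleton, *]
  · subst h1
    have : ¬ x < y := by omega
    simp [Finset.filter_insert, Finset.filter_singleton, *]
  · have : ¬ y < t := by omega
    have : ¬ x < t := by omega
    rcases lt_trichotomy x y with h2 | h2 | h2
    · have : ¬ y < x := by omega
      have : x ≠ t := by omega
      simp [Finset.filter_insert, Finset.filter_singleton, *]
    · subst h2
      simp [Finset.filter_insert, Finset.filter_singleton, *]
    · have : ¬ x < y := by omega
      have : y ≠ t := by omega
      simp [Finset.filter_insert, Finset.filter_singleton, *]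

theorem invSeqAvoidRel_eq_invSeqAvoidPat (n : ℕ) :
    invSeqAvoidRel noRel noRel (· > ·) n =
      invSeqAvoidPat ({![1, 0, 0], ![1, 1, 0], ![1, 2, 0], ![2, 0, 1], ![2, 1, 0]} :
        Set (Fin 3 → ℕ)) n := by
  ext a
  refine and_congr_right fun _ => ⟨?_, ?_⟩
  · rintro h σ hσ ⟨f, hf, rfl⟩
    refine h ⟨f 0, f 1, f 2, hf (by decide), hf (by decide), trivial, trivial, ?_⟩
    by_contra hle
    have h02 := reduction_le_reduction (w := a ∘ f) (i := 0) (j := 2) (not_lt.mp hle)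
    simp only [Set.mem_insert_iff, Set.mem_singleton_iff] at hσ
    rcases hσ with hσ | hσ | hσ | hσ | hσ <;> · rw [hσ] at h02; simp at h02
  · rintro h ⟨i, j, k, hij, hjk, -, -, hgt⟩
    refine h (reduction (a ∘ ![i, j, k])) (reduction_mem_of_lt hgt) ⟨![i, j, k], ?_, rfl⟩
    refine Fin.strictMono_iff_lt_succ.mpr fun l => ?_
    fin_cases l
    · exact hij
    · exact hjk

/-! ### Counting continuations entry by entry -/

/-- The continuations of length `m` of an inversion sequence of length `N` that avoids
`(-, -, >)`, where `p` and `q` are the maxima of its first `N - 1` and of all its entries. -/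
def continuations (N p q m : ℕ) : Set (Fin m → ℕ) :=
  {c | (∀ i : Fin m, p ≤ c i ∧ c i ≤ N + i) ∧ (∀ i : Fin m, 0 < (i : ℕ) → q ≤ c i) ∧
    ∀ i k : Fin m, (i : ℕ) + 2 ≤ k → c i ≤ c k}

theorem continuations_finite (N p q m : ℕ) : (continuations N p q m).Finite :=
  (Set.Finite.pi (t := fun i : Fin m => Set.Iic (N + i)) fun _ => Set.finite_Iic _).subset
    fun _ hc i _ => (hc.1 i).2

theorem cons_mem_continuations_iff {N p q m : ℕ} (hpq : p ≤ q) (x : ℕ) (c : Fin m → ℕ) :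
    (Fin.cons x c : Fin (m + 1) → ℕ) ∈ continuations N p q (m + 1) ↔
      x ∈ Finset.Icc p N ∧ c ∈ continuations (N + 1) q (max q x) m := by
  simp only [continuations, Set.mem_ofPred_eq, Fin.forall_fin_succ, Fin.cons_zero, Fin.cons_succ,
    Fin.val_zero, Fin.val_succ, Finset.mem_Icc, add_zero, sup_le_iff]
  constructor
  · rintro ⟨⟨hx, hc⟩, ⟨-, hq⟩, ⟨-, hx'⟩, hcc⟩
    refine ⟨hx, fun i => ⟨hq i (by omega), ?_⟩, fun i hi => ⟨hq i (by omega), hx' i (by omega)⟩,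
      fun i k hik => (hcc i).2 k (by omega)⟩
    have := (hc i).2
    omega
  · rintro ⟨hx, hc, hq, hcc⟩
    refine ⟨⟨hx, fun i => ⟨hpq.trans (hc i).1, ?_⟩⟩, ⟨by omega, fun i _ => (hc i).1⟩,
      ⟨by omega, fun i hi => (hq i (by omega)).2⟩,
      fun i => ⟨by omega, fun k hik => hcc i k (by omega)⟩⟩
    have := (hc i).2
    omega

theorem ncard_continuations_succ {N p q m : ℕ} (hpq : p ≤ q) :
    (continuations N p q (m + 1)).ncard =
      ∑ x ∈ Finset.Icc p N, (continuations (N + 1) q (max q x) m).ncard := by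
  classical
  have hinj : ∀ x : ℕ, Function.Injective (fun c : Fin m → ℕ => (Fin.cons x c : Fin (m + 1) → ℕ)) :=
    fun x => Fin.cons_right_injective (α := fun _ => ℕ) x
  have hU : continuations N p q (m + 1) = ↑((Finset.Icc p N).biUnion fun x =>
      (continuations_finite (N + 1) q (max q x) m).toFinset.image
        fun c => (Fin.cons x c : Fin (m + 1) → ℕ)) := by
    ext c
    induction c using Fin.consCases with
    | _ x c =>
      rw [cons_mem_continuations_iff hpq]
      simp only [Finset.coe_biUnion, Set.mem_iUnion, Finset.coe_image, Set.mem_image,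
        Set.Finite.coe_toFinset, Fin.cons_inj, SetLike.mem_coe]
      constructor
      · rintro ⟨hx, hc⟩
        exact ⟨x, hx, c, hc, rfl, rfl⟩
      · rintro ⟨_, hx, _, hc, rfl, rfl⟩
        exact ⟨hx, hc⟩
  rw [hU, Set.ncard_coe_finset, Finset.card_biUnion]
  · refine Finset.sum_congr rfl fun x _ => ?_
    rw [Finset.card_image_of_injective _ (hinj x), Set.ncard_eq_toFinset_card _
      (continuations_finite (N + 1) q (max q x) m)]
  · intro x _ y _ hxy
    rw [Function.onFun, Finset.disjoint_left]
    intro c hc hc'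
    obtain ⟨d, -, rfl⟩ := Finset.mem_image.mp hc
    obtain ⟨e, -, he⟩ := Finset.mem_image.mp hc'
    exact hxy (Fin.cons_inj.mp he).1.symm

/-- The number of continuations of length `m` of an avoiding inversion sequence, where `h` is its
length minus its maximum and `d` is the last increment of its running maximum. -/
def continuationCount : ℕ → ℕ → ℕ → ℕ
  | 0, _, _ => 1
  | m + 1, h, d => (d + 1) * continuationCount m (h + 1) 0 +
      ∑ j ∈ Finset.range h, continuationCount m (j + 1) (h - j)

/-- The next entry x either keeps the maximum q = p + d (`d + 1` choices, leading to `(h + 1, 0)`)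
or raises it. -/
theorem ncard_continuations (m h d p : ℕ) :
    (continuations (p + d + h) p (p + d) m).ncard = continuationCount m h d := by
  induction m generalizing h d p with
  | zero =>
    rw [continuationCount, Set.ncard_eq_one]
    refine ⟨Fin.elim0, Set.eq_singleton_iff_unique_mem.mpr ⟨?_, fun c _ => Subsingleton.elim _ _⟩⟩
    exact ⟨fun i => i.elim0, fun i => i.elim0, fun i => i.elim0⟩
  | succ m ih =>
    rw [ncard_continuations_succ (Nat.le_add_right p d), continuationCount,
      ← Finset.Ico_succ_right_eq_Icc, Nat.succ_eq_succ, Nat.succ_eq_add_one,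
      ← Finset.sum_Ico_consecutive _ (show p ≤ p + d + 1 by omega)
        (show p + d + 1 ≤ p + d + h + 1 by omega)]
    congr 1
    · rw [Finset.sum_congr rfl (g := fun _ => continuationCount m (h + 1) 0)]
      · simp; left; omega
      · intro x hx
        rw [Finset.mem_Ico] at hx
        rw [max_eq_left (by omega), ← ih (h + 1) 0 (p + d)]
        rfl
    -- After reflection j = N - x, so the new parameters are `j + 1` and `h - j`.
    · rw [Finset.sum_Ico_eq_sum_range, ← Finset.sum_range_reflect]
      refine Finset.sum_congr (by congr 1; omega) fun j hj => ?_
      rw [Finset.mem_range] at hj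
      rw [max_eq_right (by omega), ← ih (j + 1) (h - j) (p + d)]
      congr 2 <;> omega

theorem continuationCount_eq_add (m h d : ℕ) :
    continuationCount (m + 1) h d =
      continuationCount (m + 1) h 0 + d * continuationCount m (h + 1) 0 := by
  simp only [continuationCount]
  ring

/-! ### Generating functions and their recurrence in `h` -/

open PowerSeries in
/-- The generating function of `continuationCount` in the number of added entries, for
last increment `0`. -/
noncomputable def continuationSeries (h : ℕ) : PowerSeries ℚ :=
  PowerSeries.mk fun m => (continuationCount m h 0 : ℚ)

open PowerSeries in
theorem continuationSeries_eq (h : ℕ) :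
    continuationSeries h = 1 + X * (continuationSeries (h + 1) +
      ∑ j ∈ Finset.range h, (continuationSeries (j + 1) +
        ((h - j : ℕ) : PowerSeries ℚ) * (X * continuationSeries (j + 2)))) := by
  ext m
  have hn : ∀ (k : ℕ) (f : PowerSeries ℚ) (i : ℕ),
      coeff i ((k : PowerSeries ℚ) * f) = k * coeff i f := fun k f i => by
    rw [← nsmul_eq_mul, map_nsmul, nsmul_eq_mul]
  cases m with
  | zero => simp [continuationSeries, continuationCount]
  | succ m =>
    rw [map_add, coeff_succ_X_mul, map_add, map_sum, coeff_one, if_neg m.succ_ne_zero, zero_add]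
    simp only [map_add, hn, continuationSeries, coeff_mk]
    rw [continuationCount]
    push_cast
    congr 1
    · ring
    · refine Finset.sum_congr rfl fun j _ => ?_
      cases m with
      | zero => simp [continuationCount]
      | succ m =>
        rw [coeff_succ_X_mul, coeff_mk, continuationCount_eq_add]
        push_cast
        ring

open PowerSeries in
theorem continuationSeries_succ_sub (h : ℕ) :
    continuationSeries (h + 1) - continuationSeries h = X * (continuationSeries (h + 2) +
      X * ∑ j ∈ Finset.range (h + 1), continuationSeries (j + 2)) := by
  have hs : ∑ j ∈ Finset.range h, (continuationSeries (j + 1) +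
        ((h + 1 - j : ℕ) : PowerSeries ℚ) * (X * continuationSeries (j + 2))) =
      ∑ j ∈ Finset.range h, (continuationSeries (j + 1) +
        ((h - j : ℕ) : PowerSeries ℚ) * (X * continuationSeries (j + 2))) +
      X * ∑ j ∈ Finset.range h, continuationSeries (j + 2) := by
    rw [Finset.mul_sum, ← Finset.sum_add_distrib]
    refine Finset.sum_congr rfl fun j hj => ?_
    rw [Nat.sub_add_comm (Finset.mem_range.mp hj).le]
    push_cast
    ring
  rw [continuationSeries_eq (h + 1), continuationSeries_eq h, Finset.sum_range_succ, hs,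
    Finset.sum_range_succ, Nat.add_sub_cancel_left]
  push_cast
  ring

open PowerSeries in
theorem continuationSeries_recurrence (h : ℕ) :
    (X + X ^ 2) * continuationSeries (h + 3) = (1 + X) * continuationSeries (h + 2) -
      2 * continuationSeries (h + 1) + continuationSeries h := by
  have h1 := continuationSeries_succ_sub (h + 1)
  rw [Finset.sum_range_succ] at h1
  linear_combination continuationSeries_succ_sub h - h1

/-! ### The power series root of the kernel -/

open PowerSeries in
theorem eq_zero_of_forall_X_pow_dvd {R : Type*} [CommRing R] {f : PowerSeries R}
    (h : ∀ n, (X : PowerSeries R) ^ n ∣ f) : f = 0 := by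
  ext n
  exact X_pow_dvd_iff.mp (h (n + 1)) n n.lt_succ_self

open PowerSeries in
theorem exists_fixedPoint_of_contracting {R : Type*} [CommRing R]
    (Φ : PowerSeries R → PowerSeries R)
    (hΦ : ∀ f g n, (X : PowerSeries R) ^ n ∣ f - g → X ^ (n + 1) ∣ Φ f - Φ g) :
    ∃ f, Φ f = f := by
  have hstep : ∀ n, (X : PowerSeries R) ^ n ∣ Φ^[n + 1] 0 - Φ^[n] 0 := by
    intro n
    induction n with
    | zero => simp
    | succ n ih =>
      simpa only [Function.iterate_succ_apply'] using hΦ _ _ _ ih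
  have hle : ∀ m n, m ≤ n → (X : PowerSeries R) ^ m ∣ Φ^[n] 0 - Φ^[m] 0 := by
    intro m n hmn
    induction n, hmn using Nat.le_induction with
    | base => simp
    | succ n hmn ih =>
      rw [← sub_add_sub_cancel _ (Φ^[n] 0)]
      exact ((pow_dvd_pow _ hmn).trans (hstep n)).add ih
  -- The coefficient of index `n` is constant from iterate `n + 1` on.
  set f : PowerSeries R := mk fun n => coeff n (Φ^[n + 1] 0) with hf
  have hlim : ∀ n, (X : PowerSeries R) ^ n ∣ f - Φ^[n] 0 := by
    intro n
    refine X_pow_dvd_iff.mpr fun m hm => ?_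
    have := X_pow_dvd_iff.mp (hle (m + 1) n hm) m m.lt_succ_self
    rw [map_sub, sub_eq_zero] at this
    rw [map_sub, hf, coeff_mk, this, sub_self]
  refine ⟨f, sub_eq_zero.mp (eq_zero_of_forall_X_pow_dvd fun n => ?_)⟩
  have h1 := hΦ _ _ _ (hlim n)
  rw [← Function.iterate_succ_apply' Φ] at h1
  rw [← sub_sub_sub_cancel_right _ _ (Φ^[n + 1] 0)]
  exact (pow_dvd_pow _ n.le_succ).trans (h1.sub (hlim (n + 1)))

open PowerSeries in
-- Adding f cancels the only nonconstant term of the kernel without a factor z, so the map contracts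
-- z-adically; its fixed points are the kernel roots.
theorem X_pow_succ_dvd_sub_of_kernel1420 {f g : PowerSeries ℚ} {n : ℕ}
    (h : X ^ n ∣ f - g) : X ^ (n + 1) ∣ (f + kernel1420 f) - (g + kernel1420 g) := by
  have hfac : (f + kernel1420 f) - (g + kernel1420 g) = X * ((f - g) *
      (-1 + 2 * (f + g) - X * (f ^ 2 + f * g + g ^ 2))) := by
    rw [kernel1420, kernel1420]
    ring
  rw [hfac, pow_succ']
  exact mul_dvd_mul_left _ (h.mul_right _)

open PowerSeries in
theorem exists_kernel1420_eq_zero : ∃ x, kernel1420 x = 0 := by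
  obtain ⟨x, hx⟩ := exists_fixedPoint_of_contracting (fun f => f + kernel1420 f)
    fun _ _ _ => X_pow_succ_dvd_sub_of_kernel1420
  exact ⟨x, by simpa using hx⟩

open PowerSeries in
theorem X_pow_dvd_sub_of_dvd_kernel1420 {x y : PowerSeries ℚ} {n : ℕ} (hx : kernel1420 x = 0)
    (hy : X ^ n ∣ kernel1420 y) : X ^ n ∣ x - y := by
  suffices ∀ m ≤ n, X ^ m ∣ x - y from this n le_rfl
  intro m
  induction m with
  | zero => simp
  | succ m ih =>
    intro hm
    have h1 := X_pow_succ_dvd_sub_of_kernel1420 (ih (by omega))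
    have h2 := h1.add ((pow_dvd_pow X hm).trans hy)
    rw [hx] at h2
    convert h2 using 1
    ring

theorem eq_of_kernel1420_eq_zero {x y : PowerSeries ℚ} (hx : kernel1420 x = 0)
    (hy : kernel1420 y = 0) : y = x :=
  sub_eq_zero.mp (eq_zero_of_forall_X_pow_dvd fun _ =>
    X_pow_dvd_sub_of_dvd_kernel1420 hy (hx ▸ dvd_zero _))

theorem trunc_of_kernel1420_eq_zero {x : PowerSeries ℚ} (hx : kernel1420 x = 0) :
    PowerSeries.trunc 5 x = (1 + 2 * Polynomial.X + 5 * Polynomial.X ^ 2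
      + 17 * Polynomial.X ^ 3 + 64 * Polynomial.X ^ 4 : Polynomial ℚ) := by
  set p : Polynomial ℚ := 1 + 2 * Polynomial.X + 5 * Polynomial.X ^ 2
      + 17 * Polynomial.X ^ 3 + 64 * Polynomial.X ^ 4 with hp
  have hcoe : (p : PowerSeries ℚ) = 1 + 2 * PowerSeries.X + 5 * PowerSeries.X ^ 2
      + 17 * PowerSeries.X ^ 3 + 64 * PowerSeries.X ^ 4 := by
    have h (k : ℕ) : ((k : Polynomial ℚ) : PowerSeries ℚ) = k :=
      map_natCast (Polynomial.coeToPowerSeries.ringHom (R := ℚ)) k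
    have h2 := h 2
    have h5 := h 5
    have h17 := h 17
    have h64 := h 64
    push_cast at h2 h5 h17 h64
    rw [hp]
    push_cast
    rw [h2, h5, h17, h64]
  have hdeg : p.natDegree < 5 := by
    rw [hp]
    compute_degree!
  have hdvd : PowerSeries.X ^ 5 ∣ x - (p : PowerSeries ℚ) := by
    -- The witness is the kernel at `p` divided by z⁵.
    refine X_pow_dvd_sub_of_dvd_kernel1420 hx ⟨259 + 321 * PowerSeries.X + 226 * PowerSeries.X ^ 2 - 348 * PowerSeries.X ^ 3 - 5185 * PowerSeries.X ^ 4
      - 34479 * PowerSeries.X ^ 5 - 62129 * PowerSeries.X ^ 6 - 116928 * PowerSeries.X ^ 7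
      - 208896 * PowerSeries.X ^ 8 - 262144 * PowerSeries.X ^ 9, ?_⟩
    rw [hcoe, kernel1420]
    ring
  rw [← PowerSeries.trunc_coe_eq_self hdeg]
  ext n
  rw [PowerSeries.coeff_trunc, PowerSeries.coeff_trunc]
  split_ifs with hn
  · have := PowerSeries.X_pow_dvd_iff.mp hdvd n hn
    rwa [map_sub, sub_eq_zero] at this
  · rfl

/-! ### Solving the recurrence; the cubic equation -/

open PowerSeries in
theorem invSeqGF_eq_continuationSeries :
    invSeqGF noRel noRel (· > ·) = continuationSeries 0 := by
  ext n
  rw [invSeqGF, continuationSeries, coeff_mk, coeff_mk, ← ncard_continuations n 0 0 0]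
  congr 2
  ext a
  rw [mem_invSeqAvoidRel_iff, continuations]
  simp

open PowerSeries in
theorem invSeqGF_mul_eq {x : PowerSeries ℚ} (hx : kernel1420 x = 0) :
    invSeqGF noRel noRel (· > ·) * (1 - X * x - X) = 1 - X * x := by
  rw [invSeqGF_eq_continuationSeries]
  set b := continuationSeries
  set u := X * x with hu
  have hker : u * (1 - u) ^ 2 = X * (1 - u) + X ^ 2 := by
    rw [kernel1420] at hx
    linear_combination -X * hx
  -- With E the shift in `h`, the recurrence operator factors as (1 - uE) times a quadratic in E,
  -- and `D` is that quadratic applied to `b`. Since z divides u, `D h = u * D (h + 1)` forces `D`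
  -- to vanish.
  set D : ℕ → PowerSeries ℚ :=
    fun h => (1 + X + u ^ 2 - 2 * u) * b (h + 2) + (u - 2) * b (h + 1) + b h with hD
  have hDstep : ∀ h, D h = u * D (h + 1) := by
    intro h
    have := continuationSeries_recurrence h
    simp only [hD]
    linear_combination -this - b (h + 3) * hker
  have hD0 : D 0 = 0 := by
    refine eq_zero_of_forall_X_pow_dvd fun n => ?_
    suffices ∀ h, X ^ n ∣ D h from this 0
    induction n with
    | zero => simp
    | succ n ih =>
      intro h
      rw [hDstep, hu, mul_assoc, pow_succ']
      exact mul_dvd_mul_left _ ((ih _).mul_left _)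
  have h0 : b 0 = 1 + X * b 1 := by simpa using continuationSeries_eq 0
  have h1 : b 1 - b 0 = X * (b 2 + X * b 2) := by simpa using continuationSeries_succ_sub 0
  have hne : (1 - u : PowerSeries ℚ) ≠ 0 := by
    intro h
    simpa [hu] using congrArg constantCoeff h
  have h01 : (1 - u) * b 1 = b 0 := by
    refine mul_left_cancel₀ hne ?_
    simp only [hD] at hD0
    linear_combination u * hD0 - b 2 * hker + h1
  linear_combination (1 - u) * h0 + X * h01

open PowerSeries in
theorem invSeqGF_mul_eq_of_kernel1420 {x : PowerSeries ℚ} (hx : kernel1420 x = 0) :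
    invSeqGF noRel noRel (· > ·) * (X * (1 + X) * x) =
      (1 + X) * (x - 1) - X * (1 - X) * x ^ 2 := by
  have h := invSeqGF_mul_eq hx
  have hne : (1 - X * x - X : PowerSeries ℚ) ≠ 0 := by
    intro h
    simpa using congrArg constantCoeff h
  refine mul_left_cancel₀ hne ?_
  rw [kernel1420] at hx
  linear_combination X * (1 + X) * x * h + (1 - X) * hx

open PowerSeries in
theorem invSeqGF_cubic :
    -(X + 1) * invSeqGF noRel noRel (· > ·) ^ 3 + 4 * invSeqGF noRel noRel (· > ·) ^ 2
      - 4 * invSeqGF noRel noRel (· > ·) + 1 = 0 := by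
  obtain ⟨x, hx⟩ := exists_kernel1420_eq_zero
  have h := invSeqGF_mul_eq hx
  set F := invSeqGF noRel noRel (· > ·)
  set u := X * x with hu
  have hker : u * (1 - u) ^ 2 = X * (1 - u) + X ^ 2 := by
    rw [kernel1420] at hx
    linear_combination -X * hx
  -- Both relations express u rationally in F; substituting them in the kernel times (F - 1)³ leaves
  -- z² times the cubic.
  have h1 : (1 - u) * (F - 1) = X * F := by linear_combination h
  have h2 : u * (F - 1) = F - 1 - X * F := by linear_combination -h
  refine mul_left_cancel₀ (pow_ne_zero 2 (X_ne_zero (R := ℚ))) ?_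
  have h3 : (F - 1 - X * F) * (X * F) ^ 2 = X * (X * F) * (F - 1) ^ 2 + X ^ 2 * (F - 1) ^ 3 := by
    rw [← h2, ← h1]
    linear_combination (F - 1) ^ 3 * hker
  linear_combination h3

/-! ### The minimal polynomial -/

theorem toLaurent_eq (f : PowerSeries ℚ) : toLaurent f = HahnSeries.ofPowerSeries ℤ ℚ f := rfl

theorem toLaurent_injective : Function.Injective toLaurent :=
  HahnSeries.ofPowerSeries_injective

open Polynomial in
-- A root p/q in lowest terms satisfies p³(z + 1) = q(2p - q)². As p is coprime to the right side,
-- it is constant; comparing degrees then gives 1 = 3 deg q.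
theorem ratFunc_cubic_ne_zero (r : RatFunc ℚ) :
    -(RatFunc.X + 1) * r ^ 3 + 4 * r ^ 2 - 4 * r + 1 ≠ 0 := by
  intro hr
  obtain ⟨p, q, hq, hpq, rfl⟩ : ∃ p q : ℚ[X], q ≠ 0 ∧ IsCoprime p q ∧
      r = algebraMap _ _ p / algebraMap _ _ q :=
    ⟨r.num, r.denom, r.denom_ne_zero, r.isCoprime_num_denom, r.num_div_denom.symm⟩
  have hq' : algebraMap ℚ[X] (RatFunc ℚ) q ≠ 0 := RatFunc.algebraMap_ne_zero hq
  have h : p ^ 3 * (X + 1) = q * (2 * p - q) ^ 2 := by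
    apply RatFunc.algebraMap_injective ℚ
    field_simp at hr
    simp only [map_mul, map_pow, map_add, map_sub, RatFunc.algebraMap_X, map_one, map_ofNat]
    linear_combination -hr
  have hp : IsUnit p := by
    have hcop : IsCoprime p (q * (2 * p - q) ^ 2) := by
      refine hpq.mul_right (IsCoprime.pow_right ?_)
      rw [sub_eq_add_neg, add_comm, mul_comm]
      exact hpq.neg_right.add_mul_left_right 2
    refine hcop.isUnit_of_dvd' dvd_rfl ?_
    rw [← h]
    exact (dvd_pow_self p three_ne_zero).mul_right _
  obtain ⟨c, hc, rfl⟩ := isUnit_iff.mp hp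
  have hc0 : c ≠ 0 := hc.ne_zero
  have hl : (C c ^ 3 * (X + 1) : ℚ[X]).natDegree = 1 := by
    rw [← C_pow, natDegree_C_mul (pow_ne_zero _ hc0)]
    exact natDegree_X_add_C 1
  rw [h] at hl
  have h2 : (2 * C c : ℚ[X]) = C (2 * c) := by rw [C_mul]; rfl
  have hd : (2 * C c - q).natDegree = q.natDegree := by
    rw [h2, ← natDegree_neg, neg_sub, natDegree_sub_C]
  have hz : (2 * C c - q) ≠ 0 := by
    intro h0
    rw [h0] at hl
    simp at hl
  rw [natDegree_mul hq (pow_ne_zero _ hz), natDegree_pow, hd] at hl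
  omega

open Polynomial in
theorem irreducible_ratFunc_cubic : Irreducible
    (C (-(RatFunc.X + 1) : RatFunc ℚ) * X ^ 3 + 4 * X ^ 2 - 4 * X + 1) ∧
    (C (-(RatFunc.X + 1) : RatFunc ℚ) * X ^ 3 + 4 * X ^ 2 - 4 * X + 1).leadingCoeff =
      -(RatFunc.X + 1) := by
  have hne : (-(RatFunc.X + 1) : RatFunc ℚ) ≠ 0 := by
    rw [neg_ne_zero, ← RatFunc.algebraMap_X, ← map_one (algebraMap ℚ[X] (RatFunc ℚ)), ← map_add]
    exact RatFunc.algebraMap_ne_zero (X_add_C_ne_zero 1)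
  have heq : (C (-(RatFunc.X + 1) : RatFunc ℚ) * X ^ 3 + 4 * X ^ 2 - 4 * X + 1) =
      C (-(RatFunc.X + 1)) * X ^ 3 + C 4 * X ^ 2 + C (-4) * X + C 1 := by
    simp only [map_neg, map_one, map_ofNat]
    ring
  rw [heq]
  refine ⟨irreducible_of_degree_le_three_of_not_isRoot ?_ fun r hr => ?_,
    leadingCoeff_cubic hne⟩
  · rw [natDegree_cubic hne]
    decide
  · refine ratFunc_cubic_ne_zero r ?_
    rw [← heq] at hr
    simpa [IsRoot] using hr

open Polynomial in
theorem minpoly_toLaurent {F : PowerSeries ℚ}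
    (hF : -(PowerSeries.X + 1) * F ^ 3 + 4 * F ^ 2 - 4 * F + 1 = 0) :
    IsIntegral (RatFunc ℚ) (toLaurent F) ∧
      C (-(RatFunc.X + 1) : RatFunc ℚ) * minpoly (RatFunc ℚ) (toLaurent F) =
        C (-(RatFunc.X + 1) : RatFunc ℚ) * X ^ 3 + 4 * X ^ 2 - 4 * X + 1 := by
  obtain ⟨hirr, hlead⟩ := irreducible_ratFunc_cubic
  set P : (RatFunc ℚ)[X] := C (-(RatFunc.X + 1)) * X ^ 3 + 4 * X ^ 2 - 4 * X + 1 with hP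
  have hroot : aeval (toLaurent F) P = 0 := by
    have h := congrArg (HahnSeries.ofPowerSeries ℤ ℚ) hF
    simp only [map_add, map_sub, map_neg, map_mul, map_pow, map_one, map_ofNat, map_zero,
      ← toLaurent_eq] at h
    simp only [hP, map_add, map_sub, map_neg, map_mul, map_pow, map_one, map_ofNat, aeval_X,
      aeval_C, algebraMap_ratFunc_X]
    exact h
  have hlead0 : P.leadingCoeff ≠ 0 := leadingCoeff_ne_zero.mpr hirr.ne_zero
  refine ⟨IsAlgebraic.isIntegral ⟨P, hirr.ne_zero, hroot⟩, ?_⟩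
  rw [← minpoly.eq_of_irreducible hirr hroot, ← hlead, mul_comm, mul_assoc, ← C_mul,
    inv_mul_cancel₀ hlead0, C_1, mul_one]

theorem mainTheorem5 :
    -- equality of the two avoidance classes
    (∀ n : ℕ, invSeqAvoidRel noRel noRel (· > ·) n =
      invSeqAvoidPat ({![1, 0, 0], ![1, 1, 0], ![1, 2, 0], ![2, 0, 1], ![2, 1, 0]} :
        Set (Fin 3 → ℕ)) n) ∧
    -- the unique power series root of the kernel and the generating function
    (∃ x : PowerSeries ℚ,
      kernel1420 x = 0 ∧
      (∀ y : PowerSeries ℚ, kernel1420 y = 0 → y = x) ∧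
      PowerSeries.trunc 5 x =
        (1 + 2 * Polynomial.X + 5 * Polynomial.X ^ 2 + 17 * Polynomial.X ^ 3
          + 64 * Polynomial.X ^ 4 : Polynomial ℚ) ∧
      toLaurent (invSeqGF noRel noRel (· > ·)) =
        ((1 + toLaurent PowerSeries.X) * (toLaurent x - 1)
            - toLaurent PowerSeries.X * (1 - toLaurent PowerSeries.X) * toLaurent x ^ 2) /
          (toLaurent PowerSeries.X * (1 + toLaurent PowerSeries.X) * toLaurent x)) ∧
    -- the minimal polynomial over `ℚ(z)` (`minpoly` is its monic normalization)
    (IsIntegral (RatFunc ℚ) (toLaurent (invSeqGF noRel noRel (· > ·))) ∧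
      Polynomial.C (-(RatFunc.X + 1) : RatFunc ℚ) *
          minpoly (RatFunc ℚ) (toLaurent (invSeqGF noRel noRel (· > ·))) =
        Polynomial.C (-(RatFunc.X + 1) : RatFunc ℚ) * Polynomial.X ^ 3
          + 4 * Polynomial.X ^ 2 - 4 * Polynomial.X + 1) := by
  obtain ⟨x, hx⟩ := exists_kernel1420_eq_zero
  refine ⟨invSeqAvoidRel_eq_invSeqAvoidPat, ⟨x, hx, fun y hy => eq_of_kernel1420_eq_zero hx hy,
    trunc_of_kernel1420_eq_zero hx, ?_⟩, minpoly_toLaurent invSeqGF_cubic⟩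
  have h := invSeqGF_mul_eq_of_kernel1420 hx
  have hx0 : x ≠ 0 := by
    rintro rfl
    simpa [kernel1420] using congrArg PowerSeries.constantCoeff hx
  have h1 : (1 + PowerSeries.X : PowerSeries ℚ) ≠ 0 := by
    intro h
    simpa using congrArg PowerSeries.constantCoeff h
  have hne := mul_ne_zero (mul_ne_zero PowerSeries.X_ne_zero h1) hx0
  have hinj : Function.Injective (HahnSeries.ofPowerSeries ℤ ℚ) := toLaurent_injective
  have hne' := (map_ne_zero_iff _ hinj).mpr hne
  have h' := congrArg (HahnSeries.ofPowerSeries ℤ ℚ) h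
  simp only [map_add, map_sub, map_mul, map_pow, map_one, ← toLaurent_eq] at h' hne'
  exact eq_div_of_mul_eq hne' h'
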